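/- **Model.** A network is a finite connected simple undirected graph in which, at every node $v$ of degree $d$, the edges incident to $v$ carry distinct port numbers $0,\dots,d-1$ (the port numbers of an edge at its two ends are unrelated). At least two identical agents start at pairwise different nodes. Time proceeds in synchronous rounds $0,1,2,\dots$. An adversary wakes up some (at least one) of the agents in rounds of its choice; a dormant agent is also woken up when an awake agent arrives at its node. In each round after its wake-up an agent takes a port of its current node or stays idle. In each round $i\ge 0$ since its wake-up, an agent at a node of degree $d$ acquires the memory box $M_i=(d,p,q,\{(p_1,q_1,R_1),\dots,(p_k,q_k,R_k)\})$, where $p$ and $q$ are the ports by which it left the previous node and entered the current one in this round ($-1$ if it did not move), and, for each other agent $A_j$ at the same node in this round, $p_j,q_j$ are the corresponding ports of $A_j$, and $R_j$ is the memory of $A_j$ at the end of the previous round (empty if $A_j$ was dormant). Its memory is $(M_0,\dots,M_i)$. A deterministic algorithm is a function that assigns to every memory the move of the agent in the next round (a port number, or $-1$ for staying idle; a non-existing port number means staying idle) and possibly an output; all agents execute the same algorithm. In an execution, determined by an algorithm, a network, starting nodes and wake-up rounds: * *gathering with detection* is accomplished if there is a round $t$ in which all agents are awake, at the same node, and all declare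 that gathering is over, no agent has declared this in an earlier round, and all agents remain at this node forever after round $t$; * *leader election* is accomplished if there is a round $t$ in which all agents are awake, exactly one of them assigns itself value $1$ (leader) and each other agent assigns itself value $0$ (non-leader), and no agent has assigned itself a value in an earlier round. **Proposition.** Leader election is equivalent to gathering with detection: 1. for every algorithm $\mathcal A$ there is an algorithm $\mathcal B$ such that, for every network, all starting nodes and all wake-up rounds, if $\mathcal A$ accomplishes gathering with detection, then $\mathcal B$ accomplishes leader election; 2. for every algorithm $\mathcal A$ there is an algorithm $\mathcal B$ such that, for every network, all starting nodes and all wake-up rounds, if $\mathcal A$ accomplishes leader election, then $\mathcal B$ accomplishes gathering with detection. -/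

import Mathlib

namespace MobileAgents

/-- A network: a connected simple graph in which the edges incident to a node `v` of degree `d`
carry the distinct port numbers `0, …, d - 1`. The bijection `link v` sends a port number at `v` to
the neighbour it leads to (so `deg v` is the degree of `v`). The port numbers of an edge at its two
ends are unrelated. -/
structure Network (V : Type) where
  graph : SimpleGraph V
  connected : graph.Connected
  deg : V → ℕ
  link : ∀ v, Fin (deg v) ≃ graph.neighborSet v

/-- A memory box `(d, p, q, {(p₁, q₁, R₁), …, (pₖ, qₖ, Rₖ)})`: degree of the current node, port by
which the previous node was left, port by which the current node was entered, and, for every agent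
met in this round, its two ports and its memory at the end of the previous round. For an agent that
did not move both ports are `none` (written `-1` in informal notation). The memories `Rⱼ` are
stored through the injective coding `Encodable.encode : Memory → ℕ`. -/
abbrev MemoryBox : Type :=
  ℕ × Option ℕ × Option ℕ × Finset (Option ℕ × Option ℕ × ℕ)

/-- The memory of an agent is the chronological sequence `(M₀, M₁, …, Mₜ)` of its memory boxes
since its wake-up. The empty sequence is the memory of a dormant agent. -/
abbrev Memory : Type := List MemoryBox

/-- A deterministic algorithm, executed by all agents. An awake agent with memory `m` takes port
`move m` in the next round (`none`, or a port number that does not exist at its node: it stays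
idle). It issues the output `output m` if this is not `none`. -/
structure Algorithm (O : Type) where
  move : Memory → Option ℕ
  output : Memory → Option O

/-- State of an agent at the end of a round: its node, the port by which it left the previous node
and the port by which it entered the current one (`none` if it did not move in this round), and its
memory. -/
structure AgentState (V : Type) where
  node : V
  exitPort : Option ℕ
  entryPort : Option ℕ
  memory : Memory

section Execution

variable {V ι O : Type}

/-- Movement along a port: the resulting node, exit port and entry port. -/
def Network.traverse (N : Network V) (v : V) : Option ℕ → V × Option ℕ × Option ℕ
  | none => (v, none, none)
  | some p =>
    if h : p < N.deg v then
      let w := N.link v ⟨p, h⟩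
      (w.1, some p, some ((N.link w.1).symm ⟨v, SimpleGraph.Adj.symm w.2⟩ : ℕ))
    else (v, none, none)

open Classical in
/-- First half of a round: awake agents move, dormant agents stay. Memories are unchanged. -/
noncomputable def moveAgent (N : Network V) (A : Algorithm O) (s : AgentState V) : AgentState V :=
  let r := N.traverse s.node (if s.memory = [] then none else A.move s.memory)
  ⟨r.1, r.2.1, r.2.2, s.memory⟩

open Classical in
/-- The memory box acquired by agent `i`, where `s` describes all agents after the moves of the
round (with the memories from the end of the previous round). -/
noncomputable def newBox [Fintype ι] (N : Network V) (s : ι → AgentState V) (i : ι) : MemoryBox :=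
  (N.deg (s i).node, (s i).exitPort, (s i).entryPort,
    (Finset.univ.filter fun j => j ≠ i ∧ (s j).node = (s i).node).image fun j =>
      ((s j).exitPort, (s j).entryPort, Encodable.encode (s j).memory))

open Classical in
/-- Second half of a round, after the moves: a dormant agent is woken up if the adversary does so
in this round (`W i`) or if an awake agent is at its node; then every awake agent acquires a memory
box. -/
noncomputable def observe [Fintype ι] (N : Network V) (W : ι → Prop) (s : ι → AgentState V)
    (i : ι) : AgentState V :=
  { s i with
    memory :=
      if W i ∨ ∃ j, (s j).node = (s i).node ∧ (s j).memory ≠ [] then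
        (s i).memory ++ [newBox N s i]
      else [] }

/-- The execution of algorithm `A` by agents starting at the nodes `start i`: state of every agent
at the end of each round. The adversary wakes up agent `i` in round `t` if `wake i = some t` (unless
it is already awake), and never if `wake i = none`. -/
noncomputable def run [Fintype ι] (N : Network V) (start : ι → V) (wake : ι → Option ℕ)
    (A : Algorithm O) : ℕ → ι → AgentState V
  | 0 => observe N (fun i => wake i = some 0) fun i => ⟨start i, none, none, []⟩
  | t + 1 => observe N (fun i => wake i = some (t + 1)) fun i =>
      moveAgent N A (run N start wake A t i)

open Classical in
/-- The output issued by agent `i` in round `t`; a dormant agent issues none. -/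
noncomputable def outputAt [Fintype ι] (N : Network V) (start : ι → V) (wake : ι → Option ℕ)
    (A : Algorithm O) (t : ℕ) (i : ι) : Option O :=
  if (run N start wake A t i).memory = [] then none
  else A.output (run N start wake A t i).memory

/-- Gathering with detection is accomplished: there is a round `t` in which all agents are at the
same node and all declare that gathering is over (the only possible output), no agent has declared
this earlier, and the agents never leave this node after round `t`. -/
def GathersWithDetection [Fintype ι] (N : Network V) (start : ι → V) (wake : ι → Option ℕ)
    (A : Algorithm Unit) : Prop :=
  ∃ (t : ℕ) (v : V),
    (∀ i, (run N start wake A t i).node = v ∧ outputAt N start wake A t i = some ()) ∧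
    (∀ s < t, ∀ i, outputAt N start wake A s i = none) ∧
    (∀ s ≥ t, ∀ i, (run N start wake A s i).node = v)

/-- Leader election is accomplished: there is a common round `t` in which one of the agents assigns
itself value 1 (`true`) and each other agent assigns itself value 0 (`false`), and no agent has
assigned itself a value earlier. -/
def ElectsLeader [Fintype ι] (N : Network V) (start : ι → V) (wake : ι → Option ℕ)
    (A : Algorithm Bool) : Prop :=
  ∃ (t : ℕ) (l : ι),
    outputAt N start wake A t l = some true ∧
    (∀ i, i ≠ l → outputAt N start wake A t i = some false) ∧
    (∀ s < t, ∀ i, outputAt N start wake A s i = none)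

end Execution

end MobileAgents

open MobileAgents

/-! Gathering yields election because agents at one node always show different triples (exit port,
entry port, previous memory). At a first meeting two agents come from different nodes, so their
entry ports differ (one may be `none`); from then on their memories differ for good (`tripleAt_ne`).
The agent with the largest code becomes the leader.

For the converse, all agents know the number of rounds since the election. The leader follows a
fixed universal port sequence while the others wait. A waiting agent is a fixed token: its memory
shows the leader which of his rounds were spent at that node. An algorithm is an arbitrary function
of the memory, so the leader may quantify over all networks consistent with his record; he is
`Ready` once a single bound `D` makes his walk cover each of them. This happens eventually
(`exists_exploration_bound`): once the walk has made enough excursions from the token, every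
consistent network is the image of the true one under a map respecting degrees and moves, so a walk
covering the true network covers the image as well. The true network is itself consistent
(`ElectedAt.consistent`), so by `D` the leader meets every waiting agent. Whoever meets him learns
`D` and joins the universal sequence at the position given by the common clock, hence accompanies
him; at `D` all stop together. -/

namespace MobileAgents

/-! ### Executions, and why agents that have met can be told apart. -/

section Generic

variable {V ι O : Type}

/-- Taking the entry port back leads to the previous node. -/
theorem Network.traverse_reverse (N : Network V) {v w : V} {o : Option ℕ} {e : Option ℕ} {q : ℕ}
    (h : N.traverse v o = (w, e, some q)) : N.traverse w (some q) = (v, some q, e) := by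
  cases o with
  | none => simp [Network.traverse] at h
  | some p =>
    unfold Network.traverse at h
    dsimp only at h
    split_ifs at h with hp
    · simp only [Prod.mk.injEq, Option.some.injEq] at h
      obtain ⟨rfl, rfl, rfl⟩ := h
      unfold Network.traverse
      dsimp only
      rw [dif_pos (Fin.is_lt _)]
      have key : ∀ (u : V) (hu : N.graph.Adj u (N.link v ⟨p, hp⟩)), u = v →
          ((N.link u).symm ⟨(N.link v ⟨p, hp⟩ : V), hu⟩ : ℕ) = p := by
        rintro u hu rfl
        exact congrArg Fin.val ((N.link u).symm_apply_apply ⟨p, hp⟩)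
      simp only [Prod.mk.injEq, Option.some.injEq, Fin.eta, Equiv.apply_symm_apply, true_and]
      exact key _ _ (by simp)
    · simp at h

theorem Network.traverse_entry_none (N : Network V) {v w : V} {o e : Option ℕ}
    (h : N.traverse v o = (w, e, none)) : w = v := by
  cases o with
  | none => simp [Network.traverse] at h; exact h.1.symm
  | some p =>
    unfold Network.traverse at h
    dsimp only at h
    split_ifs at h with hp
    · simp at h
    · simp at h; exact h.1.symm

/-- Two agents that enter the same node from different nodes do so by different ports. -/
theorem Network.entry_ne (N : Network V) {v v' w : V} {o o' e e' q q' : Option ℕ} (hv : v ≠ v')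
    (h : N.traverse v o = (w, e, q)) (h' : N.traverse v' o' = (w, e', q')) : q ≠ q' := by
  rintro rfl
  cases q with
  | none => exact hv ((N.traverse_entry_none h).symm.trans (N.traverse_entry_none h'))
  | some q =>
    have := (N.traverse_reverse h).symm.trans (N.traverse_reverse h')
    exact hv (congrArg Prod.fst this)

/-- The recorded exit port describes the move as well as the port that was chosen. -/
theorem Network.traverse_exit (N : Network V) (v : V) (o : Option ℕ) :
    N.traverse v (N.traverse v o).2.1 = N.traverse v o := by
  cases o with
  | none => simp [Network.traverse]
  | some p =>
    unfold Network.traverse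
    dsimp only
    split_ifs with hp <;> simp [hp]

variable [Fintype ι] (N : Network V) (start : ι → V) (wake : ι → Option ℕ) (A : Algorithm O)

/-- The states of the agents after the moves of a round and before the observations. -/
noncomputable def preState : ℕ → ι → AgentState V
  | 0 => fun i => ⟨start i, none, none, []⟩
  | t + 1 => fun i => moveAgent N A (run N start wake A t i)

theorem run_eq (t : ℕ) : run N start wake A t =
    observe N (fun i => wake i = some t) (preState N start wake A t) := by
  cases t <;> rfl

/-- The node of an agent at the end of a round. -/
noncomputable abbrev nodeAt (t : ℕ) (i : ι) : V := (run N start wake A t i).node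

/-- The memory of an agent at the end of a round. -/
noncomputable abbrev memAt (t : ℕ) (i : ι) : Memory := (run N start wake A t i).memory

/-- The box an agent acquires in a round if it is awake. -/
noncomputable abbrev boxOf (t : ℕ) (i : ι) : MemoryBox := newBox N (preState N start wake A t) i

open Classical in
/-- The move that the agent makes after a round. -/
noncomputable def moveAt (t : ℕ) (i : ι) : Option ℕ :=
  if memAt N start wake A t i = [] then none else A.move (memAt N start wake A t i)

theorem node_preState (t : ℕ) (i : ι) :
    (preState N start wake A t i).node = nodeAt N start wake A t i := by
  rw [nodeAt, run_eq]; rfl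

theorem traverse_step (t : ℕ) (i : ι) :
    N.traverse (nodeAt N start wake A t i) (moveAt N start wake A t i) =
      (nodeAt N start wake A (t + 1) i, (preState N start wake A (t + 1) i).exitPort,
        (preState N start wake A (t + 1) i).entryPort) := rfl

theorem memory_preState_succ (t : ℕ) (i : ι) :
    (preState N start wake A (t + 1) i).memory = memAt N start wake A t i := rfl

theorem memory_preState_zero (i : ι) : (preState N start wake A 0 i).memory = [] := rfl

theorem memAt_of_ne_nil {t : ℕ} {i : ι} (h : memAt N start wake A t i ≠ []) :
    memAt N start wake A t i =
      (preState N start wake A t i).memory ++ [boxOf N start wake A t i] := by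
  rw [memAt, run_eq] at h ⊢
  unfold observe at h ⊢
  dsimp only at h ⊢
  split_ifs at h ⊢ with hc
  · rfl
  · exact absurd rfl h

theorem memAt_ne_nil_of_meet {t : ℕ} {i j : ι}
    (h : nodeAt N start wake A (t + 1) j = nodeAt N start wake A (t + 1) i)
    (hj : memAt N start wake A t j ≠ []) : memAt N start wake A (t + 1) i ≠ [] := by
  rw [memAt, run_eq]
  unfold observe
  dsimp only
  rw [if_pos (Or.inr ⟨j, h, hj⟩)]
  simp

theorem memAt_succ {t : ℕ} {i : ι} (h : memAt N start wake A t i ≠ []) :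
    memAt N start wake A (t + 1) i =
      memAt N start wake A t i ++ [boxOf N start wake A (t + 1) i] :=
  memAt_of_ne_nil N start wake A (memAt_ne_nil_of_meet N start wake A rfl h)

/-- What an agent tells about itself to the agents it meets. -/
noncomputable def tripleAt (t : ℕ) (i : ι) : Option ℕ × Option ℕ × ℕ :=
  ((preState N start wake A t i).exitPort, (preState N start wake A t i).entryPort,
    Encodable.encode (preState N start wake A t i).memory)

theorem mem_boxOf {t : ℕ} {i : ι} {c : Option ℕ × Option ℕ × ℕ} :
    c ∈ (boxOf N start wake A t i).2.2.2 ↔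
      ∃ j, j ≠ i ∧ nodeAt N start wake A t j = nodeAt N start wake A t i ∧
        tripleAt N start wake A t j = c := by
  simp [boxOf, newBox, tripleAt, node_preState, and_assoc]

theorem memAt_prefix {t t' : ℕ} (h : t ≤ t') (i : ι) :
    memAt N start wake A t i <+: memAt N start wake A t' i := by
  induction t', h using Nat.le_induction with
  | base => exact List.prefix_rfl
  | succ n _ ih =>
    refine ih.trans ?_
    by_cases hn : memAt N start wake A n i = []
    · rw [hn]; exact List.nil_prefix
    · rw [memAt_succ N start wake A hn]; exact List.prefix_append _ _

theorem memAt_ne_nil_mono {t t' : ℕ} (h : t ≤ t') {i : ι} (ht : memAt N start wake A t i ≠ []) :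
    memAt N start wake A t' i ≠ [] := fun h' =>
  ht (List.prefix_nil.1 (h' ▸ memAt_prefix N start wake A h i))

theorem length_memAt_add {t : ℕ} {i : ι} (ht : memAt N start wake A t i ≠ []) (s : ℕ) :
    (memAt N start wake A (t + s) i).length = (memAt N start wake A t i).length + s := by
  induction s with
  | zero => rfl
  | succ s ih =>
    rw [← add_assoc, memAt_succ N start wake A
      (memAt_ne_nil_mono N start wake A (Nat.le_add_right t s) ht), List.length_append, ih]
    simp [add_assoc]

/-- Every nonempty prefix of a memory is an earlier memory of the agent. -/
theorem exists_memAt_of_prefix {t : ℕ} {i : ι} {e : Memory} (he : e ≠ [])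
    (h : e <+: memAt N start wake A t i) : ∃ s ≤ t, memAt N start wake A s i = e := by
  induction t with
  | zero =>
    refine ⟨0, le_rfl, ?_⟩
    have hn : memAt N start wake A 0 i ≠ [] := fun h' => he (List.prefix_nil.1 (h' ▸ h))
    rw [memAt_of_ne_nil N start wake A hn, memory_preState_zero, List.nil_append] at h ⊢
    exact ((List.prefix_concat_iff (l₂ := [])).1 h).elim (fun h => h.symm)
      fun h => absurd (List.prefix_nil.1 h) he
  | succ t ih =>
    have hn : memAt N start wake A (t + 1) i ≠ [] := fun h' => he (List.prefix_nil.1 (h' ▸ h))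
    have h2 := h
    rw [memAt_of_ne_nil N start wake A hn, memory_preState_succ] at h2
    rcases List.prefix_concat_iff.1 h2 with h2 | h2
    · exact ⟨t + 1, le_rfl, by
        rw [memAt_of_ne_nil N start wake A hn, memory_preState_succ]; exact h2.symm⟩
    · obtain ⟨s, hs, hs'⟩ := ih h2
      exact ⟨s, hs.trans (Nat.le_succ t), hs'⟩

theorem exists_boxOf_of_mem {t : ℕ} {i : ι} {b : MemoryBox} (h : b ∈ memAt N start wake A t i) :
    ∃ s ≤ t, boxOf N start wake A s i = b := by
  induction t with
  | zero =>
    have hn : memAt N start wake A 0 i ≠ [] := List.ne_nil_of_mem h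
    rw [memAt_of_ne_nil N start wake A hn, memory_preState_zero, List.nil_append] at h
    exact ⟨0, le_rfl, (List.mem_singleton.1 h).symm⟩
  | succ t ih =>
    have hn : memAt N start wake A (t + 1) i ≠ [] := List.ne_nil_of_mem h
    rw [memAt_of_ne_nil N start wake A hn, memory_preState_succ] at h
    rcases List.mem_append.1 h with h | h
    · obtain ⟨s, hs, hs'⟩ := ih h
      exact ⟨s, hs.trans (Nat.le_succ t), hs'⟩
    · exact ⟨t + 1, le_rfl, (List.mem_singleton.1 h).symm⟩

theorem boxOf_mem {t s : ℕ} (h : s ≤ t) {i : ι} (hs : memAt N start wake A s i ≠ []) :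
    boxOf N start wake A s i ∈ memAt N start wake A t i :=
  (memAt_prefix N start wake A h i).subset (by rw [memAt_of_ne_nil N start wake A hs]; simp)

theorem getElem?_memAt {t : ℕ} {i : ι} (ht : memAt N start wake A t i ≠ []) {s r : ℕ}
    (hsr : s < r) :
    (memAt N start wake A (t + r) i)[(memAt N start wake A t i).length + s]? =
      some (boxOf N start wake A (t + s + 1) i) := by
  have h1 : memAt N start wake A (t + s) i ≠ [] :=
    memAt_ne_nil_mono N start wake A (Nat.le_add_right t s) ht
  obtain ⟨l, hl⟩ := memAt_prefix N start wake A (show t + s + 1 ≤ t + r by omega) i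
  rw [← hl, memAt_succ N start wake A h1, ← length_memAt_add N start wake A ht s]
  simp

theorem take_memAt {t : ℕ} {i : ι} (ht : memAt N start wake A t i ≠ []) {s r : ℕ}
    (hsr : s ≤ r) :
    (memAt N start wake A (t + r) i).take ((memAt N start wake A t i).length + s) =
      memAt N start wake A (t + s) i := by
  rw [← length_memAt_add N start wake A ht s]
  exact (List.prefix_iff_eq_take.1
    (memAt_prefix N start wake A (show t + s ≤ t + r by omega) i)).symm

variable {start} in
theorem ne_at_meeting {i j : ι} {t : ℕ} (hn : nodeAt N start wake A t i ≠ nodeAt N start wake A t j)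
    (h : nodeAt N start wake A (t + 1) i = nodeAt N start wake A (t + 1) j) :
    (preState N start wake A (t + 1) i).entryPort ≠
      (preState N start wake A (t + 1) j).entryPort :=
  N.entry_ne hn (traverse_step N start wake A t i)
    ((traverse_step N start wake A t j).trans (by rw [h]))

variable {start} in
/-- The memories of two agents are different from their first meeting on. -/
theorem memAt_ne_of_met (hstart : Function.Injective start) {i j : ι} (hij : i ≠ j) {t r : ℕ}
    (hr : r ≤ t) (h : nodeAt N start wake A r i = nodeAt N start wake A r j) :
    memAt N start wake A t i ≠ [] ∧ memAt N start wake A t j ≠ [] ∧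
      memAt N start wake A t i ≠ memAt N start wake A t j := by
  induction t generalizing r with
  | zero =>
    obtain rfl : r = 0 := by omega
    exact absurd (hstart h) hij
  | succ t ih =>
    by_cases hm : ∃ r ≤ t, nodeAt N start wake A r i = nodeAt N start wake A r j
    · obtain ⟨r', hr', h'⟩ := hm
      obtain ⟨hi, hj, hne⟩ := ih hr' h'
      refine ⟨memAt_ne_nil_mono N start wake A t.le_succ hi,
        memAt_ne_nil_mono N start wake A t.le_succ hj, fun he => hne ?_⟩
      -- Each memory grows by exactly one box, so equality now would force equality one round
      -- earlier.
      rw [memAt_succ N start wake A hi, memAt_succ N start wake A hj] at he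
      exact (List.append_inj' he rfl).1
    · push Not at hm
      obtain rfl : r = t + 1 := by
        by_contra hr'
        exact hm r (by omega) h
      have hp := ne_at_meeting N wake A (hm t le_rfl) h
      -- Two dormant agents do not move, so both entry ports would be `none`.
      have hne : memAt N start wake A t i ≠ [] ∨ memAt N start wake A t j ≠ [] := by
        by_contra! hc
        have e1 := traverse_step N start wake A t i
        have e2 := traverse_step N start wake A t j
        rw [moveAt, if_pos hc.1] at e1
        rw [moveAt, if_pos hc.2] at e2
        exact hp ((congrArg (·.2.2) e1).symm.trans (congrArg (·.2.2) e2))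
      have hi : memAt N start wake A (t + 1) i ≠ [] := hne.elim
        (memAt_ne_nil_of_meet N start wake A rfl) (memAt_ne_nil_of_meet N start wake A h.symm)
      have hj : memAt N start wake A (t + 1) j ≠ [] := hne.elim
        (memAt_ne_nil_of_meet N start wake A h) (memAt_ne_nil_of_meet N start wake A rfl)
      refine ⟨hi, hj, fun he => hp ?_⟩
      rw [memAt_of_ne_nil N start wake A hi, memAt_of_ne_nil N start wake A hj] at he
      have := (List.cons.inj (List.append_inj' he rfl).2).1
      exact congrArg (·.2.2.1) this

variable {start} in
/-- Agents at the same node can be told apart. -/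
theorem tripleAt_ne (hstart : Function.Injective start) {i j : ι} (hij : i ≠ j) {t : ℕ}
    (h : nodeAt N start wake A t i = nodeAt N start wake A t j) :
    tripleAt N start wake A t i ≠ tripleAt N start wake A t j := by
  cases t with
  | zero => exact absurd (hstart h) hij
  | succ t =>
    intro he
    by_cases hm : nodeAt N start wake A t i = nodeAt N start wake A t j
    · exact (memAt_ne_of_met N wake A hstart hij le_rfl hm).2.2
        (Encodable.encode_injective (congrArg (·.2.2) he))
    · exact ne_at_meeting N wake A hm h (congrArg (·.2.1) he)

end Generic

/-! ### From gathering to election: comparing codes. -/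

section GatheringToElection

theorem run_congr_move {V ι O O' : Type} [Fintype ι] (N : Network V) (start : ι → V)
    (wake : ι → Option ℕ) (A : Algorithm O) (B : Algorithm O') (h : A.move = B.move) (t : ℕ) :
    run N start wake A t = run N start wake B t := by
  induction t with
  | zero => rfl
  | succ t ih =>
    simp only [run, ih]
    congr 1
    funext i
    simp only [moveAgent, h]

open Classical in
/-- When gathering is declared, the agent whose code is the largest becomes the leader. -/
noncomputable def electionOfGathering (A : Algorithm Unit) : Algorithm Bool where
  move := A.move
  output m := (A.output m).map fun _ =>
    -- The default is never reached, as an awake agent has a nonempty memory. `m.dropLast` is the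
    -- memory shown to the other agents in this round, so all agents compare the same triples.
    let b := m.getLast?.getD (0, none, none, ∅)
    decide (∀ c ∈ b.2.2.2,
      Encodable.encode c < Encodable.encode (b.2.1, b.2.2.1, Encodable.encode m.dropLast))

open Classical in
theorem electsLeader_of_gathers (A : Algorithm Unit) {V : Type} (N : Network V) {ι : Type}
    [Fintype ι] [Nonempty ι] {start : ι → V} {wake : ι → Option ℕ}
    (hstart : Function.Injective start) (h : GathersWithDetection N start wake A) :
    ElectsLeader N start wake (electionOfGathering A) := by
  obtain ⟨t, v, h1, h2, -⟩ := h
  have hrun := run_congr_move N start wake (electionOfGathering A) A rfl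
  have hnode : ∀ i j, nodeAt N start wake A t i = nodeAt N start wake A t j := fun i j =>
    (h1 i).1.trans (h1 j).1.symm
  have hout : ∀ i, outputAt N start wake (electionOfGathering A) t i =
      some (decide (∀ j, j ≠ i → Encodable.encode (tripleAt N start wake A t j) <
        Encodable.encode (tripleAt N start wake A t i))) := by
    intro i
    have hi := (h1 i).2
    unfold outputAt at hi ⊢
    rw [hrun]
    split_ifs at hi ⊢ with hm
    have hm' : memAt N start wake A t i ≠ [] := hm
    simp only [electionOfGathering, hi, Option.map_some, Option.some.injEq, decide_eq_decide]
    change (∀ c ∈ ((memAt N start wake A t i).getLast?.getD _).2.2.2, _ < Encodable.encode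
      (((memAt N start wake A t i).getLast?.getD _).2.1,
        ((memAt N start wake A t i).getLast?.getD _).2.2.1,
        Encodable.encode (memAt N start wake A t i).dropLast)) ↔ _
    rw [memAt_of_ne_nil N start wake A hm']
    simp only [List.getLast?_append, List.getLast?_singleton, Option.some_or, Option.getD_some,
      List.dropLast_concat, mem_boxOf]
    constructor
    · exact fun h j hj => h _ ⟨j, hj, hnode j i, rfl⟩
    · rintro h c ⟨j, hj, -, rfl⟩
      exact h j hj
  obtain ⟨l, hl⟩ := Finite.exists_max fun i => Encodable.encode (tripleAt N start wake A t i)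
  -- Distinct triples have distinct codes, so the maximum is strict and the leader unique.
  have hlt : ∀ j, j ≠ l → Encodable.encode (tripleAt N start wake A t j) <
      Encodable.encode (tripleAt N start wake A t l) := fun j hj =>
    lt_of_le_of_ne (hl j) fun he => tripleAt_ne N wake A hstart hj (hnode j l)
      (Encodable.encode_injective he)
  refine ⟨t, l, ?_, fun i hi => ?_, fun s hs i => ?_⟩
  · rw [hout, decide_eq_true hlt]
  · rw [hout, decide_eq_false fun h => (h l hi.symm).not_gt (hlt i hi)]
  · have := h2 s hs i
    unfold outputAt at this ⊢
    rw [hrun]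
    split_ifs at this ⊢
    · rfl
    · simp [electionOfGathering, this]

end GatheringToElection

/-! ### Universal port sequence and exploration with one marked node. -/

section UniversalWalk

/-- A sequence of ports that contains every finite sequence of ports infinitely often. -/
def universalPort (n : ℕ) : ℕ :=
  ((Encodable.decode (α := List ℕ) (Nat.unpair (Nat.log 2 n)).1).getD []).getD
    (n - 2 ^ Nat.log 2 n) 0

/-- From position `s` on, the universal sequence begins with the given list. -/
def Follows : ℕ → List ℕ → Prop
  | _, [] => True
  | s, p :: w => universalPort s = p ∧ Follows (s + 1) w

theorem follows_append {s : ℕ} {a b : List ℕ} :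
    Follows s (a ++ b) ↔ Follows s a ∧ Follows (s + a.length) b := by
  induction a generalizing s with
  | nil => simp [Follows]
  | cons p a ih =>
    simp only [List.cons_append, Follows, ih, List.length_cons, and_assoc]
    rw [show s + 1 + a.length = s + (a.length + 1) by omega]

theorem follows_of_getElem {s : ℕ} {w : List ℕ}
    (h : ∀ k (hk : k < w.length), universalPort (s + k) = w[k]) : Follows s w := by
  induction w generalizing s with
  | nil => trivial
  | cons p w ih =>
    refine ⟨h 0 (by simp), ih fun k hk => ?_⟩
    rw [show s + 1 + k = s + (k + 1) by omega, h (k + 1) (by simpa using hk)]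
    rfl

/-- Block `a` occupies the positions from `2 ^ a` to `2 ^ (a + 1) - 1` and spells the list coded by
the first component of `a`. The second component is free; it is chosen so large that the block
starts after `s₀` and has room for `w`. -/
theorem exists_follows (w : List ℕ) (s₀ : ℕ) : ∃ s ≥ s₀, Follows s w := by
  set a := Nat.pair (Encodable.encode w) (s₀ + w.length) with ha
  have h1 : s₀ + w.length ≤ a := Nat.right_le_pair _ _
  have h2 : a < 2 ^ a := Nat.lt_two_pow_self
  refine ⟨2 ^ a, by omega, follows_of_getElem fun k hk => ?_⟩
  have hlog : Nat.log 2 (2 ^ a + k) = a := by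
    rw [Nat.log_eq_iff (Or.inr ⟨by norm_num, by omega⟩)]
    exact ⟨by omega, by rw [pow_succ]; omega⟩
  rw [universalPort, hlog, ha, Nat.unpair_pair, Encodable.encodek]
  simp [hk]

variable {V : Type}

/-- The node reached through the given port. -/
def Network.next (N : Network V) (v : V) (p : ℕ) : V := (N.traverse v (some p)).1

/-- The node reached in `i` rounds by following the universal sequence from position `r` on. -/
def Network.trek (N : Network V) (v : V) (r : ℕ) : ℕ → V
  | 0 => v
  | i + 1 => N.next (N.trek v r i) (universalPort (r + i))

/-- `N.Route v w l`: there is a walk from `v` to `w` with exit and entry ports as listed in `l`. -/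
inductive Network.Route (N : Network V) : V → V → List (ℕ × ℕ) → Prop
  | nil (v : V) : N.Route v v []
  | cons {v w w' : V} {p q : ℕ} {l : List (ℕ × ℕ)}
      (h : N.traverse v (some p) = (w', some p, some q)) (hl : N.Route w' w l) :
      N.Route v w ((p, q) :: l)

variable {N : Network V}

theorem Network.Route.append {u v w : V} {l l' : List (ℕ × ℕ)} (h : N.Route u v l)
    (h' : N.Route v w l') : N.Route u w (l ++ l') := by
  induction h with
  | nil => exact h'
  | cons h _ ih => exact .cons h (ih h')

/-- The list of ports of the reverse walk. -/
abbrev reverseRoute (l : List (ℕ × ℕ)) : List (ℕ × ℕ) := (l.map Prod.swap).reverse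

theorem Network.Route.symm {u v : V} {l : List (ℕ × ℕ)} (h : N.Route u v l) :
    N.Route v u (reverseRoute l) := by
  induction h with
  | nil => exact .nil _
  | cons h _ ih =>
    simp only [reverseRoute, List.map_cons, List.reverse_cons]
    exact ih.append (.cons (N.traverse_reverse h) (.nil _))

theorem Network.Route.functional {u v w : V} {l : List (ℕ × ℕ)} (h : N.Route u v l)
    (h' : N.Route u w l) : v = w := by
  induction h with
  | nil => cases h'; rfl
  | cons h _ ih =>
    cases h' with
    | cons h2 h3 =>
      obtain rfl := congrArg Prod.fst (h.symm.trans h2)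
      exact ih h3

theorem Network.exists_port (N : Network V) {v w : V} (h : N.graph.Adj v w) :
    ∃ p < N.deg v, N.next v p = w := by
  refine ⟨(N.link v).symm ⟨w, h⟩, Fin.is_lt _, ?_⟩
  simp [Network.next, Network.traverse]

theorem Network.exists_entry (N : Network V) {v : V} {p : ℕ} (h : p < N.deg v) :
    ∃ q, N.traverse v (some p) = (N.next v p, some p, some q) := by
  simp [Network.next, Network.traverse, h]

theorem Network.next_of_le (N : Network V) {v : V} {p : ℕ} (h : N.deg v ≤ p) :
    N.next v p = v := by
  simp [Network.next, Network.traverse, not_lt.2 h]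

/-- A set of nodes closed under taking ports is everything. -/
theorem Network.mem_of_closed (N : Network V) {S : Set V} {u : V} (hu : u ∈ S)
    (h : ∀ v ∈ S, ∀ p < N.deg v, N.next v p ∈ S) (w : V) : w ∈ S := by
  obtain ⟨W⟩ := N.connected.preconnected u w
  induction W with
  | nil => exact hu
  | cons ha _ ih =>
    obtain ⟨p, hp, hpw⟩ := N.exists_port ha
    exact ih (hpw ▸ h _ hu p hp)

theorem Network.exists_route (N : Network V) (u v : V) : ∃ l, N.Route u v l :=
  N.mem_of_closed (S := {v | ∃ l, N.Route u v l}) ⟨[], .nil u⟩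
    (fun _ ⟨_, hl⟩ _ hp =>
      let ⟨_, hq⟩ := N.exists_entry hp
      ⟨_, hl.append (.cons hq (.nil _))⟩) v

theorem Network.Route.foldl {u v : V} {l : List (ℕ × ℕ)} (h : N.Route u v l) :
    (l.map Prod.fst).foldl N.next u = v := by
  induction h with
  | nil => rfl
  | cons h _ ih =>
    rw [List.map_cons, List.foldl_cons, Network.next, h]
    exact ih

theorem Follows.foldl {x : ℕ → V} (hx : ∀ s, x (s + 1) = N.next (x s) (universalPort s)) {s : ℕ}
    {w : List ℕ} (h : Follows s w) : x (s + w.length) = w.foldl N.next (x s) := by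
  induction w generalizing s with
  | nil => rfl
  | cons p w ih =>
    rw [List.foldl_cons, List.length_cons, show s + (w.length + 1) = s + 1 + w.length by omega,
      ih h.2, hx, h.1]

/-- The possible starting nodes are treated one by one: wherever the list built so far leads from
the new node, a route to `v` followed by `w` is appended. Earlier starting nodes are unaffected by
an extension. -/
theorem Network.exists_list_through [Finite V] (N : Network V) (v : V) (w : List ℕ) :
    ∃ z : List ℕ, ∀ a, ∃ z₁ z₂, z = z₁ ++ w ++ z₂ ∧ z₁.foldl N.next a = v := by
  cases nonempty_fintype V
  suffices h : ∀ S : Finset V, ∃ z : List ℕ, ∀ a ∈ S, ∃ z₁ z₂, z = z₁ ++ w ++ z₂ ∧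
      z₁.foldl N.next a = v by
    obtain ⟨z, hz⟩ := h Finset.univ
    exact ⟨z, fun a => hz a (Finset.mem_univ a)⟩
  classical
  intro S
  induction S using Finset.induction_on with
  | empty => exact ⟨[], by simp⟩
  | insert b S _ ih =>
    obtain ⟨z, hz⟩ := ih
    obtain ⟨l, hl⟩ := N.exists_route (z.foldl N.next b) v
    refine ⟨z ++ l.map Prod.fst ++ w, fun a ha => ?_⟩
    rcases Finset.mem_insert.1 ha with rfl | ha
    · exact ⟨z ++ l.map Prod.fst, [], by simp, by rw [List.foldl_append, hl.foldl]⟩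
    · obtain ⟨z₁, z₂, rfl, h⟩ := hz a ha
      exact ⟨z₁, z₂ ++ l.map Prod.fst ++ w, by simp, h⟩

/-- Following the universal sequence in a finite network, one performs every finite sequence of
moves from every node, arbitrarily late. -/
theorem exists_visit_follows [Finite V] {x : ℕ → V}
    (hx : ∀ s, x (s + 1) = N.next (x s) (universalPort s)) (v : V) (w : List ℕ) (s₀ : ℕ) :
    ∃ s ≥ s₀, x s = v ∧ Follows s w := by
  obtain ⟨z, hz⟩ := N.exists_list_through v w
  obtain ⟨s, hs, hf⟩ := exists_follows z s₀
  obtain ⟨z₁, z₂, rfl, h⟩ := hz (x s)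
  rw [follows_append, follows_append] at hf
  exact ⟨s + z₁.length, by omega, (hf.1.1.foldl hx).trans h, hf.1.2⟩

theorem Network.trek_eq {x : ℕ → V} {r n : ℕ}
    (hx : ∀ s, r ≤ s → s < r + n → x (s + 1) = N.next (x s) (universalPort s)) {i : ℕ}
    (hi : i ≤ n) : N.trek (x r) r i = x (r + i) := by
  induction i with
  | zero => rfl
  | succ i ih =>
    rw [Network.trek, ih (by omega), ← hx (r + i) (by omega) (by omega)]; rfl

/-- A recorded route can be replayed in any other network that explains the record. -/
theorem Network.Route.transfer {V' : Type} {N' : Network V'} {x : ℕ → V} {x' : ℕ → V'}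
    (hx : ∀ s, x (s + 1) = N.next (x s) (universalPort s)) {r : ℕ}
    (hx' : ∀ s, 1 ≤ s → s < r →
      N'.traverse (x' s) (N.traverse (x s) (some (universalPort s))).2.1 =
        (x' (s + 1), (N.traverse (x s) (some (universalPort s))).2))
    {s : ℕ} {w : V} {l : List (ℕ × ℕ)} (hl : N.Route (x s) w l)
    (hf : Follows s (l.map Prod.fst)) (hs : 1 ≤ s) (hr : s + l.length ≤ r) :
    N'.Route (x' s) (x' (s + l.length)) l ∧ x (s + l.length) = w := by
  induction l generalizing s with
  | nil => cases hl; exact ⟨.nil _, rfl⟩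
  | cons pq l ih =>
    cases hl with
    | cons h hl =>
      obtain ⟨hp, hf⟩ := hf
      simp only [List.length_cons] at hr ⊢
      have h1 := hx' s hs (by omega)
      dsimp only at hp
      rw [hp, h] at h1
      have h2 := hx s
      rw [hp, Network.next, h] at h2
      dsimp only at h2
      obtain ⟨h3, h4⟩ := ih (h2 ▸ hl) hf (by omega) (by omega)
      rw [show s + (l.length + 1) = s + 1 + l.length by omega]
      exact ⟨.cons h1 h3, h4⟩

/-- Following the universal sequence in a finite network and recording degrees, ports and visits of
one marked node, one obtains a record that bounds the time needed to visit all nodes of whatever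
network is consistent with it. -/
theorem exists_exploration_bound [Finite V] {x : ℕ → V}
    (hx : ∀ s, x (s + 1) = N.next (x s) (universalPort s)) (u : V) :
    ∃ r D : ℕ, 1 ≤ r ∧ ∀ (V' : Type) (N' : Network V') (x' : ℕ → V'),
      (∀ s, 1 ≤ s → s ≤ r → N'.deg (x' s) = N.deg (x s)) →
      (∀ s, 1 ≤ s → s < r →
        N'.traverse (x' s) (N.traverse (x s) (some (universalPort s))).2.1 =
          (x' (s + 1), (N.traverse (x s) (some (universalPort s))).2)) →
      (∀ s s', 1 ≤ s → s < s' → s' ≤ r → x s = u → x s' = u → x' s = x' s') →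
      ∀ z, ∃ i, 1 ≤ i ∧ r + i ≤ D ∧ N'.trek (x' r) r i = z := by
  choose P hP using N.exists_route u
  have hq : ∀ (v : V) (p : Fin (N.deg v)), ∃ q,
      N.traverse v (some p) = (N.next v p, some (p : ℕ), some q) :=
    fun v p => N.exists_entry p.2
  choose q hq using hq
  -- Excursions from the token `u`: from round `τ v` the walk goes along `P v`; from round `σ v p`
  -- it goes along `P v`, through port `p`, and home along the reverse of the route chosen for the
  -- new node.
  choose τ hτ hτu hτf using fun v : V =>
    exists_visit_follows hx u ((P v ++ reverseRoute (P v)).map Prod.fst) 1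
  choose σ hσ hσu hσf using fun (v : V) (p : Fin (N.deg v)) =>
    exists_visit_follows hx u
      ((P v ++ ((p : ℕ), q v p) :: reverseRoute (P (N.next v p))).map Prod.fst) 1
  obtain ⟨r₁, hr₁⟩ := Finite.bddAbove_range fun v => τ v + (P v).length + (P v).length
  obtain ⟨r₂, hr₂⟩ := Finite.bddAbove_range fun vp : Σ v, Fin (N.deg v) =>
    σ vp.1 vp.2 + (P vp.1).length + 1 + (P (N.next vp.1 vp.2)).length
  replace hr₁ : ∀ v, τ v + (P v).length + (P v).length ≤ r₁ := fun v => hr₁ ⟨v, rfl⟩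
  replace hr₂ : ∀ (v : V) (p : Fin (N.deg v)), σ v p + (P v).length + 1 +
    (P (N.next v p)).length ≤ r₂ := fun v p => hr₂ ⟨⟨v, p⟩, rfl⟩
  -- By round `r` all excursions are over. Only after that are the visits `δ v` chosen, so that they
  -- count for the continuation of the walk.
  set r := max r₁ r₂
  have hr1 : r₁ ≤ r := le_max_left _ _
  have hr2 : r₂ ≤ r := le_max_right _ _
  choose δ hδ hδv using fun v : V => (exists_visit_follows hx v [] (r + 1)).imp
    fun _ h => And.intro h.1 h.2.1
  obtain ⟨D, hD⟩ := Finite.bddAbove_range δ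
  replace hD : ∀ v, δ v ≤ D := fun v => hD ⟨v, rfl⟩
  refine ⟨r, D, (hτ u).trans (by have := hr₁ u; omega), fun V' N' x' hdeg hstep hhome => ?_⟩
  obtain ⟨u', hu'⟩ : ∃ u', u' = x' (τ u) := ⟨_, rfl⟩
  have hhome' : ∀ s, 1 ≤ s → s ≤ r → x s = u → x' s = u' := by
    rw [hu']
    intro s hs hsr hsu
    have h1 := hr₁ u
    rcases lt_trichotomy s (τ u) with h | h | h
    · exact hhome _ _ hs h (by omega) hsu (hτu u)
    · rw [h]
    · exact (hhome _ _ (hτ u) h hsr (hτu u) hsu).symm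
  -- The graph of the map from `N` to `N'`: it is single-valued by `Route.functional`, and the
  -- following steps show that it is total, respects degrees and moves, and is onto.
  let E : V → V' → Prop := fun v z => N'.Route u' z (P v)
  have hE : ∀ v, E v (x' (τ v + (P v).length)) ∧ x (τ v + (P v).length) = v := by
    intro v
    have h1 := hr₁ v
    have h2 := hτf v
    rw [List.map_append, follows_append] at h2
    have h3 := Network.Route.transfer hx hstep ((hτu v).symm ▸ hP v) h2.1 (hτ v) (by omega)
    rwa [hhome' _ (hτ v) (by omega) (hτu v)] at h3
  have hEdeg : ∀ v z, E v z → N'.deg z = N.deg v := by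
    intro v z hz
    have h1 := hr₁ v
    have h2 := hτ v
    rw [hz.functional (hE v).1, hdeg _ (by omega) (by omega), (hE v).2]
  have hEnext : ∀ v z, E v z → ∀ p, E (N.next v p) (N'.next z p) := by
    intro v z hz p
    by_cases hp : p < N.deg v
    · set p' : Fin (N.deg v) := ⟨p, hp⟩ with hp'
      have h1 := hr₂ v p'
      have h2 := hσf v p'
      have h0 := hσ v p'
      rw [List.map_append, follows_append, List.length_map] at h2
      obtain ⟨h3, h4⟩ := Network.Route.transfer hx hstep ((hσu v p').symm ▸ hP v) h2.1 h0
        (by omega)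
      obtain ⟨h5, h6⟩ := Network.Route.transfer hx hstep
        (by rw [h4]; exact .cons (hq v p') (hP (N.next v p')).symm) h2.2 (by omega)
        (by simp; omega)
      rw [hhome' _ h0 (by omega) (hσu v p')] at h3
      rw [h3.functional hz] at h5
      -- The excursion ends at the token, so its copy in `N'` ends at `u'`; reversing the way home
      -- gives the chosen route to the new node.
      rw [hhome' _ (by omega) (by simp; omega) h6] at h5
      cases h5 with
      | cons h7 h8 =>
        have h9 := h8.symm
        simp only [reverseRoute, List.map_reverse, List.reverse_reverse, List.map_map,
          Prod.swap_swap_eq, List.map_id] at h9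
        have h10 : N'.next z p = _ := congrArg Prod.fst h7
        rw [h10]
        exact h9
    · rw [N.next_of_le (not_lt.1 hp), N'.next_of_le (by rw [hEdeg v z hz]; exact not_lt.1 hp)]
      exact hz
  have hEr : E (x r) (x' r) := by
    have h1 := hr₁ u
    have h0 := hτ u
    have : ∀ n, τ u + (P u).length ≤ n → n ≤ r → E (x n) (x' n) := by
      intro n hn
      induction n, hn using Nat.le_induction with
      | base => intro _; rw [(hE u).2]; exact (hE u).1
      | succ n hn ih =>
        intro hnr
        have h2 := hEnext _ _ (ih (by omega)) (universalPort n)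
        rw [hx]
        convert h2 using 1
        have h3 := hstep n (by omega) (by omega)
        have hd := hEdeg _ _ (ih (by omega))
        have h4 := congrArg Prod.fst h3
        dsimp only at h4
        rw [← h4]
        by_cases hp : universalPort n < N.deg (x n)
        · obtain ⟨q, hq⟩ := N.exists_entry hp
          rw [hq]; rfl
        · rw [N'.next_of_le (by omega)]
          simp [Network.traverse, hp]
    exact this r (by omega) le_rfl
  have hEtrek : ∀ i, E (x (r + i)) (N'.trek (x' r) r i) := by
    intro i
    induction i with
    | zero => exact hEr
    | succ i ih => rw [← add_assoc, hx]; exact hEnext _ _ ih _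
  have hsurj : ∀ z, ∃ v, E v z := fun z =>
    N'.mem_of_closed (S := {z | ∃ v, E v z}) ⟨_, hEr⟩
      (fun z ⟨v, hv⟩ p _ => ⟨_, hEnext v z hv p⟩) z
  intro z
  obtain ⟨v, hv⟩ := hsurj z
  have h1 := hδ v
  obtain ⟨i, hi⟩ : ∃ i, δ v = r + i := ⟨δ v - r, by omega⟩
  refine ⟨i, by omega, hi ▸ hD v, ?_⟩
  have h2 := hEtrek i
  rw [← hi, hδv] at h2
  exact h2.functional hv

end UniversalWalk

/-! ### From election to gathering: the algorithm and its correctness. -/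

section ElectionToGathering

variable (A : Algorithm Bool)

/-- The memory shows that the agent has assigned itself a value. -/
def Done (m : Memory) : Prop := ∃ k, 1 ≤ k ∧ k ≤ m.length ∧ A.output (m.take k) ≠ none

/-- Length of the memory at the time when the agent assigned itself a value. -/
noncomputable def electionLength (m : Memory) : ℕ :=
  sInf {k | 1 ≤ k ∧ k ≤ m.length ∧ A.output (m.take k) ≠ none}

/-- The memory shows that the agent is the leader. -/
def IsLeader (m : Memory) : Prop := Done A m ∧ A.output (m.take (electionLength A m)) = some true

/-- Number of rounds since the election. -/
noncomputable def clock (m : Memory) : ℕ := m.length - electionLength A m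

/-- The box acquired `s` rounds after the election. -/
noncomputable def boxAfter (m : Memory) (s : ℕ) : MemoryBox :=
  -- The box of the election round has index `electionLength A m - 1`. Only `s ≥ 1` is ever used.
  (m[electionLength A m + (s - 1)]?).getD (0, none, none, ∅)

/-- In round `s'` after the election an agent is met which has met the owner of the memory in
round `s` after the election. -/
def Revisit (m : Memory) (s s' : ℕ) : Prop :=
  ∃ c ∈ (boxAfter A m s').2.2.2, ∃ R : Memory, Encodable.encode R = c.2.2 ∧
    ∃ b ∈ R, ∃ c' ∈ b.2.2.2,
      c'.2.2 = Encodable.encode (m.take (electionLength A m + (s - 1)))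

/-- The nodes `x s`, `s` rounds after the election, explain the record in the memory `m`. -/
structure Consistent (m : Memory) {V : Type} (N : Network V) (x : ℕ → V) : Prop where
  deg : ∀ s, 1 ≤ s → s ≤ clock A m → N.deg (x s) = (boxAfter A m s).1
  step : ∀ s, 1 ≤ s → s < clock A m →
    N.traverse (x s) (boxAfter A m (s + 1)).2.1 =
      (x (s + 1), (boxAfter A m (s + 1)).2.1, (boxAfter A m (s + 1)).2.2.1)
  revisit : ∀ s s', 1 ≤ s → s < s' → s' ≤ clock A m → Revisit A m s s' → x s = x s'

/-- In every network that is consistent with the record of the leader, following the universal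
sequence of ports leads him to all nodes until round `D` after the election. -/
def Certifies (m : Memory) (D : ℕ) : Prop :=
  IsLeader A m ∧ ∀ (V : Type) (N : Network V) (x : ℕ → V), Consistent A m N x →
    ∀ z, ∃ i, 1 ≤ i ∧ clock A m + i ≤ D ∧ N.trek (x (clock A m)) (clock A m) i = z

/-- The leader knows how long he has to walk in order to visit all nodes. -/
def Ready (m : Memory) : Prop := ∃ D, Certifies A m D

/-- The leader with memory `m` has fixed round `D` after the election for the end of gathering. -/
def IsDeadline (m : Memory) (D : ℕ) : Prop :=
  ∃ e, e <+: m ∧ Ready A e ∧ (∀ e', e' <+: m → Ready A e' → e.length ≤ e'.length) ∧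
    D = sInf {D | Certifies A e D}

/-- The agent is the leader and has fixed the deadline `D`, or it has learned `D` from him. -/
def Knows (m : Memory) (D : ℕ) : Prop :=
  IsDeadline A m D ∨ ∃ b ∈ m, ∃ c ∈ b.2.2.2, ∃ R : Memory,
    Encodable.encode R = c.2.2 ∧ IsDeadline A R D

open Classical in
/-- After the election the leader follows the universal sequence of ports and the other agents stay
idle until they learn the deadline. From then on they follow the universal sequence, too, and are
thus always at the node of the leader. At the deadline everybody stops. -/
noncomputable def gatheringOfElection : Algorithm Unit where
  move m :=
    if ¬ Done A m then A.move m
    else if ∃ D, Knows A m D ∧ D ≤ clock A m then none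
    else if IsLeader A m ∨ ∃ D, Knows A m D then some (universalPort (clock A m))
    else none
  output m := if Done A m ∧ ∃ D, Knows A m D ∧ D ≤ clock A m then some () else none

variable {V ι : Type} [Fintype ι]

/-- The algorithm `B` obtained from `A` is executed, and agent `l` is elected in round `T`. -/
structure ElectedAt (B : Algorithm Unit) (N : Network V) (start : ι → V) (wake : ι → Option ℕ)
    (T : ℕ) (l : ι) : Prop where
  alg : B = gatheringOfElection A
  not_done : ∀ t < T, ∀ i, ¬ Done A (memAt N start wake B t i)
  ne_nil : ∀ i, memAt N start wake B T i ≠ []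
  leader : A.output (memAt N start wake B T l) = some true
  follower : ∀ i, i ≠ l → A.output (memAt N start wake B T i) = some false

variable {A} {N : Network V} {start : ι → V} {wake : ι → Option ℕ}

/-- Agent `i` knows the deadline that the leader `l` has fixed in round `t₀`. -/
def Informed (N : Network V) (start : ι → V) (wake : ι → Option ℕ) (B : Algorithm Unit)
    (l : ι) (t₀ t : ℕ) (i : ι) : Prop :=
  (i = l ∧ t₀ ≤ t) ∨ ∃ u, t₀ ≤ u ∧ u < t ∧ l ≠ i ∧
    nodeAt N start wake B (u + 1) l = nodeAt N start wake B (u + 1) i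

theorem Informed.mono {B : Algorithm Unit} {l : ι} {t₀ t t' : ℕ} (htt : t ≤ t') {i : ι}
    (h : Informed N start wake B l t₀ t i) : Informed N start wake B l t₀ t' i := by
  rcases h with ⟨hi, ht⟩ | ⟨u, h1, h2, h3⟩
  · exact Or.inl ⟨hi, ht.trans htt⟩
  · exact Or.inr ⟨u, h1, h2.trans_le htt, h3⟩

/-- A box of round `u + 1` carries memories from the end of round `u`; those seen in round 0 are
empty and fix no deadline. -/
theorem knows_cases {B : Algorithm Unit} {t : ℕ} {i : ι} {D : ℕ} (hD : Knows A (memAt N start wake B t i) D) :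
    IsDeadline A (memAt N start wake B t i) D ∨ ∃ u < t, ∃ j, j ≠ i ∧
      nodeAt N start wake B (u + 1) j = nodeAt N start wake B (u + 1) i ∧
      IsDeadline A (memAt N start wake B u j) D := by
  rcases hD with hD | ⟨b, hb, c, hc, R, hR, hD⟩
  · exact Or.inl hD
  · obtain ⟨t', ht', rfl⟩ := exists_boxOf_of_mem N start wake B hb
    obtain ⟨j, hj, hn, rfl⟩ := (mem_boxOf N start wake B).1 hc
    obtain rfl : R = _ := Encodable.encode_injective hR
    cases t' with
    | zero =>
      obtain ⟨e, he, hr, -⟩ := hD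
      rw [memory_preState_zero, List.prefix_nil] at he
      subst he
      obtain ⟨k, h1, h2, -⟩ := hr.choose_spec.1.1
      rw [List.length_nil] at h2
      omega
    | succ u => exact Or.inr ⟨u, ht', j, hj, hn, hD⟩

theorem knows_of_meet {B : Algorithm Unit} {t u : ℕ} (hu : u < t) {i j : ι} (hij : j ≠ i) {D : ℕ}
    (hn : nodeAt N start wake B (u + 1) j = nodeAt N start wake B (u + 1) i)
    (hnil : memAt N start wake B u j ≠ []) (hD : IsDeadline A (memAt N start wake B u j) D) :
    Knows A (memAt N start wake B t i) D :=
  Or.inr ⟨_, boxOf_mem N start wake B hu (memAt_ne_nil_of_meet N start wake B hn hnil), _,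
    (mem_boxOf N start wake B).2 ⟨j, hij, hn, rfl⟩, _, rfl, hD⟩

theorem next_of_moveAt {B : Algorithm Unit} {T s : ℕ} {i : ι}
    (hm : moveAt N start wake B (T + s) i = some (universalPort s)) :
    nodeAt N start wake B (T + (s + 1)) i =
      N.next (nodeAt N start wake B (T + s) i) (universalPort s) := by
  have := traverse_step N start wake B (T + s) i
  rw [hm] at this
  exact (congrArg Prod.fst this).symm

theorem stay_of_moveAt {B : Algorithm Unit} {T s : ℕ} {i : ι} (hm : moveAt N start wake B (T + s) i = none) :
    nodeAt N start wake B (T + (s + 1)) i = nodeAt N start wake B (T + s) i := by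
  have := traverse_step N start wake B (T + s) i
  rw [hm] at this
  exact (congrArg Prod.fst this).symm

/-- Until someone is `Done`, the new algorithm moves like `A`, so both executions agree up to the
election. -/
theorem exists_electedAt (h : ElectsLeader N start wake A) :
    ∃ T l, ElectedAt A (gatheringOfElection A) N start wake T l := by
  obtain ⟨T, l, h1, h2, h3⟩ := h
  have hout : ∀ t i b, outputAt N start wake A t i = some b →
      memAt N start wake A t i ≠ [] ∧ A.output (memAt N start wake A t i) = some b := by
    intro t i b h
    unfold outputAt at h
    split_ifs at h with hm
    exact ⟨hm, h⟩
  have hnone : ∀ t < T, ∀ i, ¬ Done A (memAt N start wake A t i) := by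
    rintro t ht i ⟨k, hk, hk', hne⟩
    have hnil : (memAt N start wake A t i).take k ≠ [] := fun h => by
      have := congrArg List.length h
      rw [List.length_take, List.length_nil] at this
      omega
    obtain ⟨s, hs, hse⟩ := exists_memAt_of_prefix N start wake A hnil (List.take_prefix _ _)
    have := h3 s (hs.trans_lt ht) i
    unfold outputAt at this
    rw [if_neg (by rw [← memAt, hse]; exact hnil), ← memAt, hse] at this
    exact hne this
  have hrun : ∀ t ≤ T, run N start wake (gatheringOfElection A) t = run N start wake A t := by
    intro t
    induction t with
    | zero => exact fun _ => rfl
    | succ t ih =>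
      intro ht
      simp only [run, ih (by omega)]
      congr 1
      funext i
      have : (gatheringOfElection A).move (run N start wake A t i).memory =
          A.move (run N start wake A t i).memory := if_pos (hnone t (by omega) i)
      simp only [moveAgent, this]
  refine ⟨T, l, rfl, fun t ht i => ?_, fun i => ?_, ?_, fun i hi => ?_⟩
  · rw [memAt, hrun t ht.le]; exact hnone t ht i
  · rw [memAt, hrun T le_rfl]
    by_cases hi : i = l
    · exact (hout _ _ _ (hi ▸ h1)).1
    · exact (hout _ _ _ (h2 i hi)).1
  · rw [memAt, hrun T le_rfl]; exact (hout _ _ _ h1).2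
  · rw [memAt, hrun T le_rfl]; exact (hout _ _ _ (h2 i hi)).2

namespace ElectedAt

variable {B : Algorithm Unit} {T : ℕ} {l : ι} (h : ElectedAt A B N start wake T l)
include h

theorem output_ne_none (i : ι) : A.output (memAt N start wake B T i) ≠ none := by
  by_cases hi : i = l
  · rw [hi, h.leader]; simp
  · rw [h.follower i hi]; simp

theorem mem_ne_nil (s : ℕ) (i : ι) : memAt N start wake B (T + s) i ≠ [] :=
  memAt_ne_nil_mono N start wake B (Nat.le_add_right T s) (h.ne_nil i)

theorem take_length (s : ℕ) (i : ι) :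
    (memAt N start wake B (T + s) i).take (memAt N start wake B T i).length =
      memAt N start wake B T i := take_memAt N start wake B (h.ne_nil i) (Nat.zero_le s)

theorem mem_election (s : ℕ) (i : ι) : (memAt N start wake B T i).length ∈
    {k | 1 ≤ k ∧ k ≤ (memAt N start wake B (T + s) i).length ∧
      A.output ((memAt N start wake B (T + s) i).take k) ≠ none} :=
  ⟨List.length_pos_iff.2 (h.ne_nil i),
    (memAt_prefix N start wake B (Nat.le_add_right T s) i).length_le,
    by rw [h.take_length]; exact h.output_ne_none i⟩

theorem done (s : ℕ) (i : ι) : Done A (memAt N start wake B (T + s) i) := ⟨_, h.mem_election s i⟩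

theorem electionLength_eq (s : ℕ) (i : ι) : electionLength A (memAt N start wake B (T + s) i) =
    (memAt N start wake B T i).length := by
  refine le_antisymm (Nat.sInf_le (h.mem_election s i)) (not_lt.1 fun hlt => ?_)
  obtain ⟨h1, h2, h3⟩ := Nat.sInf_mem (h.done s i)
  change 1 ≤ electionLength A _ at h1
  change electionLength A _ ≤ _ at h2
  change A.output (List.take (electionLength A _) _) ≠ none at h3
  set k := electionLength A (memAt N start wake B (T + s) i)
  set e := (memAt N start wake B (T + s) i).take k with he
  have hlen : e.length = k := List.length_take_of_le h2
  have hnil : e ≠ [] := List.length_pos_iff.1 (by omega)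
  have hpre : e <+: memAt N start wake B T i :=
    List.prefix_of_prefix_length_le (List.take_prefix _ _)
      (memAt_prefix N start wake B (Nat.le_add_right T s) i) (by omega)
  obtain ⟨t, ht, hte⟩ := exists_memAt_of_prefix N start wake B hnil hpre
  have htT : t ≠ T := by
    rintro rfl
    rw [hte] at hlt
    omega
  refine h.not_done t (by omega) i ⟨k, h1, ?_, ?_⟩
  · rw [hte, hlen]
  · rwa [hte, ← hlen, List.take_length]

theorem clock_eq (s : ℕ) (i : ι) : clock A (memAt N start wake B (T + s) i) = s := by
  rw [clock, h.electionLength_eq, length_memAt_add N start wake B (h.ne_nil i)]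
  omega

theorem isLeader_iff (s : ℕ) (i : ι) : IsLeader A (memAt N start wake B (T + s) i) ↔ i = l := by
  rw [IsLeader, h.electionLength_eq, h.take_length]
  by_cases hi : i = l
  · subst hi
    simp [h.done s i, h.leader]
  · simp [hi, h.follower i hi]

theorem take_eq {s r : ℕ} (hsr : s ≤ r) (i : ι) :
    (memAt N start wake B (T + r) i).take
      (electionLength A (memAt N start wake B (T + r) i) + s) =
      memAt N start wake B (T + s) i := by
  rw [h.electionLength_eq, take_memAt N start wake B (h.ne_nil i) hsr]

theorem boxAfter_eq {s r : ℕ} (hs : 1 ≤ s) (hsr : s ≤ r) (i : ι) :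
    boxAfter A (memAt N start wake B (T + r) i) s = boxOf N start wake B (T + s) i := by
  rw [boxAfter, h.electionLength_eq,
    getElem?_memAt N start wake B (h.ne_nil i) (show s - 1 < r by omega), Option.getD_some,
    show T + (s - 1) + 1 = T + s by omega]

/-- A memory of a leader is a memory of agent `l` from after the election. -/
theorem eq_of_isLeader {t : ℕ} {i : ι} {e : Memory} (he : e <+: memAt N start wake B t i)
    (hl : IsLeader A e) : i = l ∧ ∃ s, T + s ≤ t ∧ e = memAt N start wake B (T + s) l := by
  have hnil : e ≠ [] := by
    rintro rfl
    obtain ⟨k, h1, h2, -⟩ := hl.1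
    rw [List.length_nil] at h2
    omega
  obtain ⟨t', ht, rfl⟩ := exists_memAt_of_prefix N start wake B hnil he
  have hT : T ≤ t' := not_lt.1 fun hlt => h.not_done t' hlt i hl.1
  obtain ⟨s, rfl⟩ := Nat.exists_eq_add_of_le hT
  obtain rfl := (h.isLeader_iff s i).1 hl
  exact ⟨rfl, s, ht, rfl⟩

theorem ready_of_isDeadline {t : ℕ} {i : ι} {D : ℕ}
    (hD : IsDeadline A (memAt N start wake B t i) D) :
    i = l ∧ ∃ s, T + s ≤ t ∧ Ready A (memAt N start wake B (T + s) l) ∧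
      (∀ s', T + s' ≤ t → Ready A (memAt N start wake B (T + s') l) → s ≤ s') ∧
      D = sInf {D | Certifies A (memAt N start wake B (T + s) l) D} := by
  obtain ⟨e, he, hr, hmin, rfl⟩ := hD
  obtain ⟨rfl, s, hs, rfl⟩ := h.eq_of_isLeader he hr.choose_spec.1
  refine ⟨rfl, s, hs, hr, fun s' hs' hr' => ?_, rfl⟩
  have := hmin _ (memAt_prefix N start wake B hs' i) hr'
  rw [length_memAt_add N start wake B (h.ne_nil i),
    length_memAt_add N start wake B (h.ne_nil i)] at this
  omega

open Classical in
theorem moveAt_eq (s : ℕ) (i : ι) : moveAt N start wake B (T + s) i =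
    if ∃ D, Knows A (memAt N start wake B (T + s) i) D ∧ D ≤ s then none
    else if i = l ∨ ∃ D, Knows A (memAt N start wake B (T + s) i) D then some (universalPort s)
    else none := by
  have hB := h.alg
  rw [moveAt, if_neg (h.mem_ne_nil s i)]
  conv_lhs => rw [show B.move = (gatheringOfElection A).move by rw [hB]]
  simp only [gatheringOfElection, h.done s i, h.clock_eq, h.isLeader_iff, not_true_eq_false,
    if_false]

theorem outputAt_eq (t : ℕ) (i : ι) : outputAt N start wake B t i = some () ↔
    ∃ s, t = T + s ∧ ∃ D, Knows A (memAt N start wake B t i) D ∧ D ≤ s := by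
  have hB := h.alg
  rw [outputAt, ← memAt, show B.output = (gatheringOfElection A).output by rw [hB]]
  by_cases ht : t < T
  · have : ¬ ∃ s, t = T + s ∧ ∃ D, Knows A (memAt N start wake B t i) D ∧ D ≤ s := by
      rintro ⟨s, hs, -⟩
      omega
    simp [gatheringOfElection, h.not_done t ht i, this]
  · obtain ⟨s, rfl⟩ := Nat.exists_eq_add_of_le (not_lt.1 ht)
    simp [gatheringOfElection, h.mem_ne_nil s i, h.done s i, h.clock_eq]

/-! ### The leader explores while the others wait. -/

section BeforeReady

variable {n : ℕ} (hn : ∀ s < n, ¬ Ready A (memAt N start wake B (T + s) l))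
include hn

theorem not_knows {s : ℕ} (hs : s < n) (i : ι) (D : ℕ) :
    ¬ Knows A (memAt N start wake B (T + s) i) D := by
  intro hD
  rcases knows_cases hD with hD | ⟨u, hu, j, -, -, hD⟩
  all_goals
    obtain ⟨-, s', hs', hr, -⟩ := h.ready_of_isDeadline hD
    exact hn s' (by omega) hr

theorem moveAt_leader {s : ℕ} (hs : s < n) :
    moveAt N start wake B (T + s) l = some (universalPort s) := by
  simp [h.moveAt_eq, h.not_knows hn hs]

theorem node_follower {s : ℕ} (hs : s ≤ n) {i : ι} (hi : i ≠ l) :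
    nodeAt N start wake B (T + s) i = nodeAt N start wake B T i := by
  induction s with
  | zero => rfl
  | succ s ih =>
    rw [stay_of_moveAt (by simp [h.moveAt_eq, h.not_knows hn (show s < n by omega), hi]),
      ih (by omega)]

/-- This makes the leader's certificate apply to the actual network. -/
theorem consistent : Consistent A (memAt N start wake B (T + n) l) N
    fun s => nodeAt N start wake B (T + s) l where
  deg s hs hsn := by
    rw [h.clock_eq] at hsn
    rw [h.boxAfter_eq hs hsn, ← node_preState]
    rfl
  step s hs hsn := by
    rw [h.clock_eq] at hsn
    rw [h.boxAfter_eq (by omega) (by omega)]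
    have h1 := traverse_step N start wake B (T + s) l
    have h2 := N.traverse_exit (nodeAt N start wake B (T + s) l)
      (moveAt N start wake B (T + s) l)
    rw [h1] at h2
    exact h2
  revisit s s' hs hss hsn hR := by
    rw [h.clock_eq] at hsn
    obtain ⟨c, hc, R, hR, b, hb, c', hc', hm⟩ := hR
    rw [h.boxAfter_eq (by omega) hsn] at hc
    obtain ⟨j, hj, hjn, rfl⟩ := (mem_boxOf N start wake B).1 hc
    obtain rfl : R = _ := Encodable.encode_injective hR
    obtain ⟨s', rfl⟩ := Nat.exists_eq_add_of_lt (show 0 < s' by omega)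
    rw [show T + (0 + s' + 1) = T + s' + 1 by omega, memory_preState_succ] at hb
    obtain ⟨t, ht, rfl⟩ := exists_boxOf_of_mem N start wake B hb
    obtain ⟨i, hi, hin, rfl⟩ := (mem_boxOf N start wake B).1 hc'
    rw [h.take_eq (by omega)] at hm
    replace hm := Encodable.encode_injective hm
    -- Only `l` ever has a leader's memory, so the agent that `j` had met is `l`, and the length of
    -- that memory gives the round. Since `j` has not moved, both meetings are at the same node.
    have hlead := (h.isLeader_iff (s - 1) l).2 rfl
    rw [← hm] at hlead
    cases t with
    | zero => exact absurd hm.symm (h.mem_ne_nil _ _)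
    | succ u =>
      rw [memory_preState_succ] at hm hlead
      have hu : T ≤ u := not_lt.1 fun hlt => h.not_done u hlt i hlead.1
      obtain ⟨u, rfl⟩ := Nat.exists_eq_add_of_le hu
      obtain rfl := (h.isLeader_iff u i).1 hlead
      have hus := congrArg List.length hm
      rw [length_memAt_add N start wake B (h.ne_nil i),
        length_memAt_add N start wake B (h.ne_nil i)] at hus
      obtain rfl : s = u + 1 := by omega
      change nodeAt N start wake B (T + (u + 1)) i = _ at hin
      change nodeAt N start wake B (T + (u + 1)) i = nodeAt N start wake B (T + (0 + s' + 1)) i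
      rw [hin, ← hjn]
      exact (h.node_follower hn (s := u + 1) (by omega) hj).trans
        (h.node_follower hn hsn hj).symm

end BeforeReady

/-- Were the leader never ready, he would walk forever and `j` would stay put, which is the setting
of `exists_exploration_bound` with `j` as the token. -/
theorem exists_ready [Finite V] {j : ι} (hj : j ≠ l) :
    ∃ r, Ready A (memAt N start wake B (T + r) l) := by
  by_contra! hn
  replace hn : ∀ n, ∀ s < n, ¬ Ready A (memAt N start wake B (T + s) l) := fun _ s _ => hn s
  have hmove : ∀ s, moveAt N start wake B (T + s) l = some (universalPort s) := fun s =>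
    h.moveAt_leader (hn (s + 1)) s.lt_succ_self
  have hstay : ∀ s, nodeAt N start wake B (T + s) j = nodeAt N start wake B T j := fun s =>
    h.node_follower (hn s) le_rfl hj
  obtain ⟨r, D, hr, hD⟩ := exists_exploration_bound
    (x := fun s => nodeAt N start wake B (T + s) l) (N := N)
    (fun s => next_of_moveAt (hmove s)) (nodeAt N start wake B T j)
  refine hn (r + 1) r r.lt_succ_self ⟨D, (h.isLeader_iff r l).2 rfl, fun V' N' x' hx' => ?_⟩
  have hc := h.clock_eq r l
  rw [hc]
  refine hD V' N' x' (fun s hs hsr => ?_) (fun s hs hsr => ?_) fun s s' hs hss hsr hsu hsu' => ?_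
  · rw [hx'.deg s hs (hc.symm ▸ hsr), h.boxAfter_eq hs hsr, ← node_preState]
    rfl
  · have h1 := hx'.step s hs (hc.symm ▸ hsr)
    rw [h.boxAfter_eq (by omega) hsr] at h1
    have h2 := traverse_step N start wake B (T + s) l
    rw [hmove] at h2
    rw [h2]
    exact h1
  · refine hx'.revisit s s' hs hss (hc.symm ▸ hsr) ?_
    obtain ⟨p, rfl⟩ : ∃ p, s = p + 1 := ⟨s - 1, by omega⟩
    obtain ⟨p', rfl⟩ : ∃ p', s' = p' + 1 := ⟨s' - 1, by omega⟩
    -- The memory that `j` shows at the later meeting contains its box of the earlier one, where the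
    -- leader showed his memory of round `T + p`.
    refine ⟨tripleAt N start wake B (T + (p' + 1)) j, ?_, memAt N start wake B (T + p') j, rfl,
      boxOf N start wake B (T + (p + 1)) j,
      boxOf_mem N start wake B (by omega) (h.mem_ne_nil _ _),
      tripleAt N start wake B (T + (p + 1)) l, ?_, ?_⟩
    · rw [h.boxAfter_eq (by omega) hsr]
      exact (mem_boxOf N start wake B).2 ⟨j, hj, (hstay _).trans hsu'.symm, rfl⟩
    · exact (mem_boxOf N start wake B).2 ⟨l, hj.symm, hsu.trans (hstay _).symm, rfl⟩
    · rw [h.take_eq (by omega)]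
      rfl

/-! ### The deadline spreads and the agents gather. -/

section AfterReady

variable {r D : ℕ} (hr : Ready A (memAt N start wake B (T + r) l))
  (hmin : ∀ s < r, ¬ Ready A (memAt N start wake B (T + s) l))
  (hD : D = sInf {D | Certifies A (memAt N start wake B (T + r) l) D})
include hr hmin hD

/-- The shortest ready prefix of the leader's memory does not change once it exists, so only one
deadline ever circulates. -/
theorem isDeadline_iff {t : ℕ} {i : ι} {D' : ℕ} :
    IsDeadline A (memAt N start wake B t i) D' ↔ i = l ∧ T + r ≤ t ∧ D' = D := by
  constructor
  · intro hD'
    obtain ⟨hi, s, hs, hrs, hle, rfl⟩ := h.ready_of_isDeadline hD'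
    have hrs' : r ≤ s := not_lt.1 fun hlt => hmin s hlt hrs
    obtain rfl : s = r := le_antisymm (hle r (by omega) hr) hrs'
    exact ⟨hi, hs, hD.symm⟩
  · rintro ⟨rfl, ht, rfl⟩
    refine ⟨_, memAt_prefix N start wake B ht i, hr, fun e he hre => ?_, hD⟩
    obtain ⟨-, s, -, rfl⟩ := h.eq_of_isLeader he hre.choose_spec.1
    have hrs : r ≤ s := not_lt.1 fun hlt => hmin s hlt hre
    exact (memAt_prefix N start wake B (show T + r ≤ T + s by omega) i).length_le

theorem knows_iff {t : ℕ} {i : ι} {D' : ℕ} :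
    Knows A (memAt N start wake B t i) D' ↔
      D' = D ∧ Informed N start wake B l (T + r) t i := by
  constructor
  · intro hk
    rcases knows_cases hk with hd | ⟨u, hu, j, hj, hn, hd⟩
    · obtain ⟨hi, ht, hDD⟩ := (h.isDeadline_iff hr hmin hD).1 hd
      exact ⟨hDD, Or.inl ⟨hi, ht⟩⟩
    · obtain ⟨rfl, ht, hDD⟩ := (h.isDeadline_iff hr hmin hD).1 hd
      exact ⟨hDD, Or.inr ⟨u, ht, hu, hj, hn⟩⟩
  · rintro ⟨rfl, ⟨rfl, ht⟩ | ⟨u, h1, h2, h3, h4⟩⟩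
    · exact Or.inl ((h.isDeadline_iff hr hmin hD).2 ⟨rfl, ht, rfl⟩)
    · refine knows_of_meet h2 h3 h4 ?_ ((h.isDeadline_iff hr hmin hD).2 ⟨rfl, h1, rfl⟩)
      obtain ⟨s, rfl⟩ := Nat.exists_eq_add_of_le (show T ≤ u by omega)
      exact h.mem_ne_nil s l

theorem moveAt_of_lt {s : ℕ} (hs : s < D) {i : ι}
    (hi : i = l ∨ Informed N start wake B l (T + r) (T + s) i) :
    moveAt N start wake B (T + s) i = some (universalPort s) := by
  have h1 : ¬ ∃ D', Knows A (memAt N start wake B (T + s) i) D' ∧ D' ≤ s := by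
    rintro ⟨D', hk, hle⟩
    rw [h.knows_iff hr hmin hD] at hk
    omega
  rw [h.moveAt_eq, if_neg h1, if_pos]
  exact hi.imp id fun hi => ⟨D, (h.knows_iff hr hmin hD).2 ⟨rfl, hi⟩⟩

theorem moveAt_of_not_informed {s : ℕ} {i : ι} (hi : i ≠ l)
    (hn : ¬ Informed N start wake B l (T + r) (T + s) i) :
    moveAt N start wake B (T + s) i = none := by
  simp [h.moveAt_eq, h.knows_iff hr hmin hD, hi, hn]

theorem moveAt_of_le {s : ℕ} (hs : D ≤ s) {i : ι}
    (hi : Informed N start wake B l (T + r) (T + s) i) :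
    moveAt N start wake B (T + s) i = none := by
  rw [h.moveAt_eq, if_pos ⟨D, (h.knows_iff hr hmin hD).2 ⟨rfl, hi⟩, hs⟩]

/-- Until the deadline, the informed agents are with the leader and the others have not moved since
the election. -/
theorem node_cases {s : ℕ} (hs : s ≤ D) {i : ι} (hi : i ≠ l) :
    (Informed N start wake B l (T + r) (T + s) i ∧
      nodeAt N start wake B (T + s) i = nodeAt N start wake B (T + s) l) ∨
    (¬ Informed N start wake B l (T + r) (T + s) i ∧
      nodeAt N start wake B (T + s) i = nodeAt N start wake B T i) := by
  induction s with
  | zero =>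
    refine Or.inr ⟨?_, rfl⟩
    rintro (⟨rfl, -⟩ | ⟨u, h1, h2, -⟩)
    · exact hi rfl
    · omega
  | succ s ih =>
    rcases ih (by omega) with ⟨h1, h2⟩ | ⟨h1, h2⟩
    · refine Or.inl ⟨h1.mono (by omega), ?_⟩
      rw [next_of_moveAt (h.moveAt_of_lt hr hmin hD hs (Or.inr h1)),
        next_of_moveAt (h.moveAt_of_lt hr hmin hD hs (Or.inl rfl)), h2]
    · have h3 := stay_of_moveAt (h.moveAt_of_not_informed hr hmin hD hi h1)
      by_cases h4 : Informed N start wake B l (T + r) (T + (s + 1)) i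
      · refine Or.inl ⟨h4, ?_⟩
        rcases h4 with ⟨rfl, -⟩ | ⟨u, h5, h6, h7, h8⟩
        · exact absurd rfl hi
        · obtain rfl : u = T + s := by
            by_contra hu
            exact h1 (Or.inr ⟨u, h5, by omega, h7, h8⟩)
          exact h8.symm
      · exact Or.inr ⟨h4, h3.trans h2⟩

theorem informed_deadline (i : ι) : Informed N start wake B l (T + r) (T + D) i ∧
    nodeAt N start wake B (T + D) i = nodeAt N start wake B (T + D) l := by
  have hc : Certifies A (memAt N start wake B (T + r) l) D := hD ▸ Nat.sInf_mem hr
  obtain ⟨k, hk, hkD, hkn⟩ := hc.2 V N _ (h.consistent hmin) (nodeAt N start wake B T i)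
  rw [h.clock_eq] at hkD hkn
  by_cases hi : i = l
  · subst hi
    exact ⟨Or.inl ⟨rfl, by omega⟩, rfl⟩
  have hwalk : ∀ s, r ≤ s → s < r + k → nodeAt N start wake B (T + (s + 1)) l =
      N.next (nodeAt N start wake B (T + s) l) (universalPort s) := fun s _ hs =>
    next_of_moveAt (h.moveAt_of_lt hr hmin hD (hs.trans_le hkD) (Or.inl rfl))
  have htrek := Network.trek_eq (x := fun s => nodeAt N start wake B (T + s) l) hwalk le_rfl
  replace hkn := htrek.symm.trans hkn
  have hinf : Informed N start wake B l (T + r) (T + (r + k)) i := by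
    rcases h.node_cases hr hmin hD hkD hi with ⟨h1, -⟩ | ⟨-, h2⟩
    · exact h1
    -- A meeting transmits memories of the previous round; since `k ≥ 1`, the leader was already
    -- ready then.
    · refine Or.inr ⟨T + (r + k) - 1, by omega, by omega, Ne.symm hi, ?_⟩
      rw [show T + (r + k) - 1 + 1 = T + (r + k) by omega, hkn, h2]
  rcases h.node_cases hr hmin hD le_rfl hi with h1 | ⟨h1, -⟩
  · exact h1
  · exact absurd (hinf.mono (by omega)) h1

theorem gathers : GathersWithDetection N start wake B := by
  have hinf := h.informed_deadline hr hmin hD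
  have hstay : ∀ s ≥ D, ∀ i, nodeAt N start wake B (T + s) i =
      nodeAt N start wake B (T + D) i := by
    intro s hs i
    induction s, hs using Nat.le_induction with
    | base => rfl
    | succ s hs ih =>
      rw [stay_of_moveAt (h.moveAt_of_le hr hmin hD hs ((hinf i).1.mono (by omega))), ih]
  refine ⟨T + D, nodeAt N start wake B (T + D) l, fun i => ⟨(hinf i).2, ?_⟩, fun s hs i => ?_,
    fun s hs i => ?_⟩
  · exact (h.outputAt_eq _ i).2
      ⟨D, rfl, D, (h.knows_iff hr hmin hD).2 ⟨rfl, (hinf i).1⟩, le_rfl⟩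
  · by_contra hne
    obtain ⟨⟨⟩, hu⟩ := Option.ne_none_iff_exists'.1 hne
    obtain ⟨s', rfl, D', hk, hle⟩ := (h.outputAt_eq _ i).1 hu
    rw [h.knows_iff hr hmin hD] at hk
    omega
  · obtain ⟨s', rfl⟩ := Nat.exists_eq_add_of_le (show T ≤ s by omega)
    exact (hstay s' (by omega) i).trans (hinf i).2

end AfterReady

end ElectedAt

theorem gathers_of_electsLeader [Finite V] (hι : 2 ≤ Fintype.card ι)
    (h : ElectsLeader N start wake A) :
    GathersWithDetection N start wake (gatheringOfElection A) := by
  classical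
  obtain ⟨T, l, h⟩ := exists_electedAt h
  have : Nontrivial ι := Fintype.one_lt_card_iff_nontrivial.1 hι
  obtain ⟨j, hj⟩ := exists_ne l
  have hex := h.exists_ready hj
  exact h.gathers (Nat.find_spec hex) (fun s hs => Nat.find_min hex hs) rfl

end ElectionToGathering

end MobileAgents

theorem mainTheorem4 :
    (∀ A : Algorithm Unit, ∃ B : Algorithm Bool,
      ∀ (V : Type) [Finite V] (N : Network V) (ι : Type) [Fintype ι] (start : ι → V)
        (wake : ι → Option ℕ),
        2 ≤ Fintype.card ι → Function.Injective start → (∃ i t, wake i = some t) →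
        GathersWithDetection N start wake A → ElectsLeader N start wake B) ∧
    (∀ A : Algorithm Bool, ∃ B : Algorithm Unit,
      ∀ (V : Type) [Finite V] (N : Network V) (ι : Type) [Fintype ι] (start : ι → V)
        (wake : ι → Option ℕ),
        2 ≤ Fintype.card ι → Function.Injective start → (∃ i t, wake i = some t) →
        ElectsLeader N start wake A → GathersWithDetection N start wake B) := by
  refine ⟨fun A => ⟨electionOfGathering A, ?_⟩, fun A => ⟨gatheringOfElection A, ?_⟩⟩
  · intro V _ N ι _ start wake hι hstart _ h
    have : Nonempty ι := Fintype.card_pos_iff.1 (by omega)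
    exact electsLeader_of_gathers A N hstart h
  · intro V _ N ι _ start wake hι _ _ h
    exact gathers_of_electsLeader hι h
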